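/- USTCON is the following problem: given a simple undirected graph $G=(V,E)$ with $n$ nodes, not necessarily connected, and two nodes $s,t\in V$, decide whether $s$ and $t$ lie in the same connected component of $G$. Model. The nodes are $0,\dots,n-1$, and each node $v$ has an arbitrary port numbering, i.e. a bijection $\mathrm{PORT}_v$ from its neighbours $\Gamma(v)$ onto $\{0,\dots,\deg(v)-1\}$. An algorithm is a single program, the same for all inputs, for a random access machine with registers holding natural numbers, initially containing $n,s,t$. The unit-cost instructions are: loading a constant, addition, truncated subtraction, indirect reading and writing, jump if positive, the graph queries $\deg(v)$, $\mathrm{PORT}_v(u)$ and $\mathrm{PORT}_v^{-1}(i)$, the choice of a uniformly random integer from $\{0,\dots,d-1\}$, where $d$ is the content of a register, and halting with answer "connected" or "not connected". Time is the number of instructions executed. Space is the maximum, over the configurations of a run, of the total bit length of the addresses and contents of all nonzero registers. The unit-potential Metropolis–Hastings walk $RW(G_1)$ is the random walk on $V$ which moves from $v$ along an arc with probability proportional to the weight of the arc, where an arc $(v,u)$ with $\{v,u\}\in E$ has weight $w(v,u)=\min\{1/\deg(v),1/\deg(u)\}$ and the loop at $v$ has weight $1-\sum_{u\in\Gamma(v)}w(v,u)$.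 Theorem. (a) If $s$ and $t$ are in the same connected component of a graph $G$ with $n$ nodes, then the walk $RW(G_1)$ started from $s$ visits $t$ within its first $\lfloor 24n^2\ln n\rfloor$ steps with probability at least $1-\frac1n$ (hence also within $24n^2\log_2 n$ steps). (b) There is a randomized log-space algorithm for USTCON running in time $O(n^2\log n)$ with one-sided error at most $\frac1n$. That is, there are a program and functions $T(n)=O(n^2\log n)$, $S(n)=O(\log n)$ such that on every input with $n$ nodes, with every port numbering, every run (for all random choices) halts with an answer within $T(n)$ steps and uses at most $S(n)$ bits of space; if $s$ and $t$ are in different components, the answer "connected" has probability $0$; if they are in the same component, the answer "not connected" has probability at most $\frac1n$. Moreover, the program runs the walk $RW(G_1)$ from $s$ for $24n^2\lceil\log_2 n\rceil$ steps and reports whether it has visited $t$: there are a line and a register of the program such that the successive contents of the register, at the moments of the run when the machine is at this line, are distributed exactly as the positions of $RW(G_1)$ at times $0,1,\dots,24n^2\lceil\log_2 n\rceil$, and the answer is "connected" if and only if $t$ is among these contents. -/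

import Mathlib

open scoped ENNReal

noncomputable section

namespace USTCON

/-- The law of the sequence of the first `k + 1` states (times `0, …, k`) of the time-homogeneous
Markov process with transition law `K`, started at a given state. -/
def trajectory {α : Type*} (K : α → PMF α) : ℕ → α → PMF (List α)
  | 0, a => PMF.pure [a]
  | k + 1, a => (K a).bind fun b => (trajectory K k b).map (List.cons a)

section Walk

variable {V : Type*} [Fintype V] [DecidableEq V] (G : SimpleGraph V) [DecidableRel G.Adj]

/-- The arc weights of the weighted graph `G_f`: an arc `(v, u)` of an edge has weight
`min (f v / deg v) (f u / deg u)`, and the loop at `v` has the remaining weight, so that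
the arcs out of `v` have total weight `f v`. Pairs that are not arcs have weight `0`. -/
def mhWeight (f : V → ℝ) (v u : V) : ℝ :=
  if u = v then f v - ∑ x ∈ G.neighborFinset v, min (f v / G.degree v) (f x / G.degree x)
  else if G.Adj v u then min (f v / G.degree v) (f u / G.degree u)
  else 0

theorem sum_mhWeight (f : V → ℝ) (v : V) : ∑ u, mhWeight G f v u = f v := by
  rw [← Finset.add_sum_erase _ _ (Finset.mem_univ v)]
  have h : ∑ u ∈ Finset.univ.erase v, mhWeight G f v u
      = ∑ x ∈ G.neighborFinset v, min (f v / G.degree v) (f x / G.degree x) := by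
    have hsub : G.neighborFinset v ⊆ Finset.univ.erase v := by
      intro x hx
      have : G.Adj v x := by simpa using hx
      simp [this.ne']
    rw [← Finset.sum_subset hsub]
    · refine Finset.sum_congr rfl fun x hx => ?_
      have hx' : G.Adj v x := by simpa using hx
      simp [mhWeight, hx'.ne', hx']
    · intro x hx hx'
      have h1 : x ≠ v := by simpa using hx
      have h2 : ¬ G.Adj v x := by simpa using hx'
      simp [mhWeight, h1, h2]
  rw [h]
  simp [mhWeight]

/-- One step of the Metropolis–Hastings walk `RW(G_f)` with a positive potential `f`: from `v` it
moves to `u` with probability proportional to the weight of the arc `(v, u)`. -/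
def mhStep (f : V → ℝ) (hf : ∀ v, 0 < f v) (v : V) : PMF V :=
  PMF.normalize (fun u => ENNReal.ofReal (mhWeight G f v u))
    (by
      intro h
      rw [ENNReal.tsum_eq_zero] at h
      have h1 : ∑ u, mhWeight G f v u ≤ 0 :=
        Finset.sum_nonpos fun u _ => ENNReal.ofReal_eq_zero.1 (h u)
      rw [sum_mhWeight] at h1
      exact absurd (hf v) (not_lt.2 h1))
    (by
      rw [tsum_fintype]
      exact ENNReal.sum_ne_top.2 fun u _ => ENNReal.ofReal_ne_top)

/-- The law of the positions at times `0, …, N` of the walk `RW(G_1)` (unit potential),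
started at `s`. -/
def unitWalk (N : ℕ) (s : V) : PMF (List V) :=
  trajectory (mhStep G (fun _ => 1) fun _ => one_pos) N s

end Walk

/-- Instructions of a probabilistic random access machine. The registers `X 0, X 1, …` hold natural
numbers. To the usual instructions (constants, addition, subtraction, indirect reading
and writing, conditional jump) are added the three queries to the input graph, the choice of
a uniformly random integer, and two halting instructions which give the answer. -/
inductive Instr : Type
  /-- `X i ← k` -/
  | const (i k : ℕ)
  /-- `X i ← X a + X b` -/
  | add (i a b : ℕ)
  /-- `X i ← max (X a - X b) 0` -/
  | sub (i a b : ℕ)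
  /-- `X i ← X (X a)` -/
  | load (i a : ℕ)
  /-- `X (X a) ← X b` -/
  | store (a b : ℕ)
  /-- go to line `l` if `X a > 0` -/
  | jumpPos (a l : ℕ)
  /-- `X i ← deg (X a)` -/
  | degree (i a : ℕ)
  /-- `X i ←` the port at node `X a` that leads to its neighbour `X b` -/
  | port (i a b : ℕ)
  /-- `X i ←` the neighbour of node `X a` behind its port number `X b` -/
  | neighbor (i a b : ℕ)
  /-- `X i ←` uniformly random element of `{0, …, X a - 1}` -/
  | random (i a : ℕ)
  /-- halt with the answer "connected" -/
  | accept
  /-- halt with the answer "not connected" -/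
  | reject

/-- A program is a finite list of instructions, at the lines `0, 1, 2, …`. -/
abbrev Program : Type := List Instr

/-- A configuration of the machine: current line and contents of the registers, all but finitely
many of which are `0`. -/
structure Config : Type where
  line : ℕ
  mem : ℕ →₀ ℕ

/-- The number of bits in use: the lengths of the addresses and of the contents of all
nonzero registers. -/
def Config.space (c : Config) : ℕ := c.mem.sum fun i x => Nat.size i + Nat.size x

/-- Write `x` into register `i` and go to the next line. -/
def Config.write (c : Config) (i x : ℕ) : Config := ⟨c.line + 1, c.mem.update i x⟩

/-- At the start, the number of nodes, `s` and `t` are in the registers `0, 1, 2`, all other registers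
are `0`, and the machine is at line `0`. -/
def Config.init {n : ℕ} (s t : Fin n) : Config :=
  ⟨0, Finsupp.single 0 n + Finsupp.single 1 (s : ℕ) + Finsupp.single 2 (t : ℕ)⟩

/-- A uniformly random element of `{0, …, d - 1}` (and `0` if `d = 0`). -/
def uniformBelow (d : ℕ) : PMF ℕ :=
  if h : 0 < d then PMF.uniformOfFinset (Finset.range d) ⟨0, Finset.mem_range.2 h⟩
  else PMF.pure 0

section Machine

variable {n : ℕ} (G : SimpleGraph (Fin n)) [DecidableRel G.Adj]
  (port : ∀ v : Fin n, G.neighborSet v ≃ Fin (G.degree v))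

/-- The answer to a degree query; `0` if `a` is not a node. -/
def degreeQuery (a : ℕ) : ℕ := if h : a < n then G.degree ⟨a, h⟩ else 0

/-- The answer to a port query `PORT_a(b)`; `0` if `a`, `b` are not adjacent nodes. -/
def portQuery (a b : ℕ) : ℕ :=
  if h : ∃ (ha : a < n) (hb : b < n), G.Adj ⟨a, ha⟩ ⟨b, hb⟩ then
    (port ⟨a, h.1⟩ ⟨⟨b, h.2.1⟩, h.2.2⟩ : ℕ)
  else 0

/-- The answer to an edge traversal query `PORT_a⁻¹(b)`; `0` if `a` is not a node or has no
port `b`. -/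
def neighborQuery (a b : ℕ) : ℕ :=
  if h : ∃ ha : a < n, b < G.degree ⟨a, ha⟩ then
    (((port ⟨a, h.1⟩).symm ⟨b, h.2⟩ : Fin n) : ℕ)
  else 0

/-- One step of the program `P` on the input graph `G` with its port numbering. The machine stays where
it is at a halting instruction, and also at a line that does not exist. -/
def step (P : Program) (c : Config) : PMF Config :=
  match P[c.line]? with
  | none => PMF.pure c
  | some (.const i k) => PMF.pure (c.write i k)
  | some (.add i a b) => PMF.pure (c.write i ((c.mem a) + c.mem b))
  | some (.sub i a b) => PMF.pure (c.write i (c.mem a - c.mem b))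
  | some (.load i a) => PMF.pure (c.write i (c.mem (c.mem a)))
  | some (.store a b) => PMF.pure (c.write (c.mem a) (c.mem b))
  | some (.jumpPos a l) => PMF.pure ⟨if 0 < c.mem a then l else c.line + 1, c.mem⟩
  | some (.degree i a) => PMF.pure (c.write i (degreeQuery G (c.mem a)))
  | some (.port i a b) => PMF.pure (c.write i (portQuery G port (c.mem a) (c.mem b)))
  | some (.neighbor i a b) => PMF.pure (c.write i (neighborQuery G port (c.mem a) (c.mem b)))
  | some (.random i a) => (uniformBelow (c.mem a)).map fun x => c.write i x
  | some .accept => PMF.pure c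
  | some .reject => PMF.pure c

/-- The law of the first `k` steps (as a list of `k + 1` configurations) of the program `P` on the
input consisting of `G`, its port numbering, and the nodes `s` and `t`. -/
def execution (P : Program) (s t : Fin n) (k : ℕ) : PMF (List Config) :=
  trajectory (step G port P) k (Config.init s t)

end Machine

/-- The answer given in a configuration: `true` for "connected", `false` for "not connected";
`none` if the machine has not halted with an answer. -/
def Config.answer (P : Program) (c : Config) : Option Bool :=
  match P[c.line]? with
  | some .accept => some true
  | some .reject => some false
  | _ => none

/-- The answer given at the end of a finite sequence of configurations. -/
def answer (P : Program) (τ : List Config) : Option Bool := τ.getLast?.bind (Config.answer P)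

/-- The successive contents of register `r` at those moments when the machine is at line `l`. -/
def record (l r : ℕ) (τ : List Config) : List ℕ :=
  (τ.filter fun c => c.line = l).map fun c => c.mem r

end USTCON

end

/-! With unit potential the arc weights are symmetric and sum to one at every node. An arc between
distinct adjacent nodes `v`, `u` has weight `1 / max (deg v) (deg u)`, that is, resistance `max (deg
v) (deg u)`. Along a shortest path to `t` a node of the graph is adjacent to at most three path
nodes, so the degrees on the path add up to at most `3n` (`sum_degree_le_of_dist`), and the
resistance between two connected nodes is at most `6n` (`resistance_le`).

For a symmetric chain such a bound controls hitting times: the Dirichlet energy of the truncated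
expected hitting time is at most twice its sum, and comparison at its maximum bounds it by `6n * n`
(`sum_missProb_le`). By Markov's inequality, `12n²` steps miss `t` with probability at most `1/2`
from any node of the component; repeating this `⌈log₂ n⌉` times leaves at most `1/n`
(`missProb_mhWeight_le`). Since `⌈log₂ n⌉ ≤ 2 ln n`, the `24 n² ln n` steps suffice.

The machine makes one step of the walk by proposing a uniform port and accepting the neighbour `u`
with probability `min 1 (deg v / deg u)` (`roundLaw_eq`). The explicit program is executed
symbolically: `obs` packs the recorded positions, the answer and the boundedness of the registers
into one law, and `walkObs_init` identifies this law with an image of the law of the walk. Time,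
space, error and faithfulness of the simulation are all read off from this single equation. -/

noncomputable section

namespace USTCON

/-! ### Truncated hitting times of symmetric Markov chains -/

section Chain

variable {V : Type*} [Fintype V] [DecidableEq V]

/-- The probability that the chain with transition matrix `K` started at `v` does not visit `t`
at the times `0, …, k`. -/
def missProb (K : V → V → ℝ) (t : V) : ℕ → V → ℝ
  | 0, v => if v = t then 0 else 1
  | k + 1, v => if v = t then 0 else ∑ u, K v u * missProb K t k u

variable {K : V → V → ℝ} {t : V}

@[simp]
theorem missProb_self (k : ℕ) : missProb K t k t = 0 := by
  cases k <;> simp [missProb]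

theorem missProb_nonneg (h0 : ∀ v u, 0 ≤ K v u) (k : ℕ) (v : V) : 0 ≤ missProb K t k v := by
  induction k generalizing v with
  | zero => simp only [missProb]; split_ifs <;> norm_num
  | succ k ih =>
    simp only [missProb]
    split_ifs
    · exact le_rfl
    · exact Finset.sum_nonneg fun u _ => mul_nonneg (h0 v u) (ih u)

theorem missProb_succ_le (h0 : ∀ v u, 0 ≤ K v u) (h1 : ∀ v, ∑ u, K v u = 1) (k : ℕ) (v : V) :
    missProb K t (k + 1) v ≤ missProb K t k v := by
  induction k generalizing v with
  | zero =>
    simp only [missProb]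
    split_ifs
    · exact le_rfl
    · refine (Finset.sum_le_sum fun u _ => mul_le_of_le_one_right (h0 v u) ?_).trans (h1 v).le
      split_ifs <;> norm_num
  | succ k ih =>
    rw [missProb, missProb]
    split_ifs
    · exact le_rfl
    · exact Finset.sum_le_sum fun u _ => mul_le_mul_of_nonneg_left (ih u) (h0 v u)

theorem missProb_antitone (h0 : ∀ v u, 0 ≤ K v u) (h1 : ∀ v, ∑ u, K v u = 1) (v : V) :
    Antitone fun k => missProb K t k v :=
  antitone_nat_of_succ_le fun k => missProb_succ_le h0 h1 k v

/-- The Markov property at time `k`: a path that has avoided `t` so far is still in the closed class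
`C`, where the bound `b` applies afresh. -/
theorem missProb_add_le (h0 : ∀ v u, 0 ≤ K v u) {C : V → Prop}
    (hC : ∀ v u, C v → K v u ≠ 0 → C u) {m : ℕ} {b : ℝ} (hb : ∀ v, C v → missProb K t m v ≤ b)
    (k : ℕ) {v : V} (hv : C v) : missProb K t (k + m) v ≤ missProb K t k v * b := by
  induction k generalizing v with
  | zero =>
    by_cases h : v = t
    · simp [h]
    · simpa [missProb, h] using hb v hv
  | succ k ih =>
    rw [show k + 1 + m = (k + m) + 1 by ring, missProb, missProb]
    split_ifs
    · simp
    · rw [Finset.sum_mul]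
      refine Finset.sum_le_sum fun u _ => ?_
      by_cases hK : K v u = 0
      · simp [hK]
      · rw [mul_assoc]
        exact mul_le_mul_of_nonneg_left (ih (hC v u hv hK)) (h0 v u)

theorem missProb_mul_le (h0 : ∀ v u, 0 ≤ K v u) {C : V → Prop}
    (hC : ∀ v u, C v → K v u ≠ 0 → C u) {m : ℕ} {b : ℝ} (hb0 : 0 ≤ b)
    (hb : ∀ v, C v → missProb K t m v ≤ b) (j : ℕ) {v : V} (hv : C v) :
    missProb K t (j * m) v ≤ b ^ j := by
  induction j with
  | zero => simp only [Nat.zero_mul, missProb, pow_zero]; split_ifs <;> norm_num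
  | succ j ih =>
    rw [Nat.succ_mul, pow_succ]
    exact (missProb_add_le h0 hC hb _ hv).trans (mul_le_mul_of_nonneg_right ih hb0)

omit [DecidableEq V] in
-- Summation by parts: after expanding the square, both diagonal terms equal `∑ g²`, one by the row
-- sums and the other by symmetry.
theorem dirichlet_energy (hs : ∀ v u, K v u = K u v) (h1 : ∀ v, ∑ u, K v u = 1) (g : V → ℝ) :
    ∑ v, ∑ u, K v u * (g v - g u) ^ 2 = 2 * ∑ v, g v * (g v - ∑ u, K v u * g u) := by
  have e1 : ∑ v, ∑ u, K v u * g v ^ 2 = ∑ v, g v ^ 2 := by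
    refine Finset.sum_congr rfl fun v _ => ?_
    rw [← Finset.sum_mul, h1, one_mul]
  have e2 : ∑ v, ∑ u, K v u * g u ^ 2 = ∑ v, g v ^ 2 := by
    rw [Finset.sum_comm, ← e1]
    exact Finset.sum_congr rfl fun v _ => Finset.sum_congr rfl fun u _ => by rw [hs]
  have e3 : ∑ v, g v * ∑ u, K v u * g u = ∑ v, ∑ u, K v u * (g v * g u) := by
    refine Finset.sum_congr rfl fun v _ => ?_
    rw [Finset.mul_sum]
    exact Finset.sum_congr rfl fun u _ => by ring
  have e4 : ∑ v, ∑ u, K v u * (g v - g u) ^ 2 = ∑ v, ∑ u, K v u * g v ^ 2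
      + ∑ v, ∑ u, K v u * g u ^ 2 - 2 * ∑ v, ∑ u, K v u * (g v * g u) := by
    simp only [Finset.mul_sum, ← Finset.sum_add_distrib, ← Finset.sum_sub_distrib]
    exact Finset.sum_congr rfl fun v _ => Finset.sum_congr rfl fun u _ => by ring
  rw [e4, e1, e2, ← e3]
  simp only [mul_sub, Finset.sum_sub_distrib, ← pow_two]
  ring

/-- A bound on the effective resistance within a closed class of states bounds the truncated
hitting times. -/
theorem sum_missProb_le (hs : ∀ v u, K v u = K u v) (h0 : ∀ v u, 0 ≤ K v u)
    (h1 : ∀ v, ∑ u, K v u = 1) {C : V → Prop} (hC : ∀ v u, C v → K v u ≠ 0 → C u)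
    {R : ℝ} (hR0 : 0 ≤ R)
    (hR : ∀ (g : V → ℝ) (v), C v → 2 * (g v - g t) ^ 2 ≤ R * ∑ x, ∑ y, K x y * (g x - g y) ^ 2)
    (N : ℕ) {v : V} (hv : C v) :
    ∑ k ∈ Finset.range N, missProb K t k v ≤ R * Fintype.card V := by
  classical
  -- This is the expectation of `min(τ, N)`, with `τ` the hitting time of `t`; truncation makes
  -- finiteness automatic and turns the hitting-time equation into the inequality `hdrift`.
  set h : V → ℝ := fun v => ∑ k ∈ Finset.range N, missProb K t k v with hh
  have hnn : ∀ v, 0 ≤ h v := fun v => Finset.sum_nonneg fun k _ => missProb_nonneg h0 k v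
  have hdrift : ∀ v, v ≠ t → h v - ∑ u, K v u * h u ≤ 1 := by
    intro v hvt
    have e1 : ∑ k ∈ Finset.range (N + 1), missProb K t k v = 1 + ∑ u, K v u * h u := by
      rw [Finset.sum_range_succ']
      simp only [missProb, hvt, if_false, hh, Finset.mul_sum]
      rw [Finset.sum_comm, add_comm]
    have e2 : h v ≤ ∑ k ∈ Finset.range (N + 1), missProb K t k v := by
      rw [Finset.sum_range_succ]
      exact le_add_of_nonneg_right (missProb_nonneg h0 N v)
    linarith
  -- Outside `C` the node `t` may be unreachable and `h` as large as `N`. The cut-off costs nothing,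
  -- since no transition leaves `C`.
  set g : V → ℝ := fun v => if C v then h v else 0 with hg
  have hgt : g t = 0 := by simp [hg, hh]
  have hg0 : ∀ v, 0 ≤ g v := fun v => by
    simp only [hg]; split_ifs
    · exact hnn v
    · exact le_rfl
  have hpt : ∀ v, g v * (g v - ∑ u, K v u * g u) ≤ g v := by
    intro v
    by_cases hvt : v = t
    · rw [hvt, hgt]; simp
    by_cases hCv : C v
    · refine mul_le_of_le_one_right (hg0 v) ?_
      have : ∑ u, K v u * g u = ∑ u, K v u * h u := by
        refine Finset.sum_congr rfl fun u _ => ?_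
        by_cases hK : K v u = 0
        · simp [hK]
        · simp [hg, hC v u hCv hK]
      rw [this]
      simpa [hg, hCv] using hdrift v hvt
    · simp [hg, hCv]
  -- At a maximum `m` the chain `2 g(m)² ≤ R · energy ≤ 2R ∑ g ≤ 2R |V| g(m)` can be divided by
  -- `g(m)`.
  obtain ⟨m, -, hm⟩ := Finset.exists_max_image Finset.univ g ⟨v, Finset.mem_univ v⟩
  have hgv : g v = h v := by simp [hg, hv]
  change h v ≤ _
  rw [← hgv]
  refine (hm v (Finset.mem_univ v)).trans ?_
  rcases (hg0 m).eq_or_lt with h' | hpos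
  · rw [← h']; positivity
  have hCm : C m := by
    by_contra hn
    simp [hg, hn] at hpos
  have key := hR g m hCm
  rw [dirichlet_energy hs h1, hgt, sub_zero] at key
  have hsum : ∑ v, g v * (g v - ∑ u, K v u * g u) ≤ Fintype.card V * g m := by
    calc _ ≤ ∑ v, g v := Finset.sum_le_sum fun v _ => hpt v
      _ ≤ ∑ _v : V, g m := Finset.sum_le_sum fun v _ => hm v (Finset.mem_univ v)
      _ = _ := by simp
  have := mul_le_mul_of_nonneg_left hsum hR0
  refine le_of_mul_le_mul_right ?_ hpos
  nlinarith

end Chain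

/-! ### Effective resistance of the Metropolis–Hastings weights -/

section Resistance

variable {V : Type*} [Fintype V] [DecidableEq V] (G : SimpleGraph V) [DecidableRel G.Adj]

omit [DecidableEq V] in
-- Double counting: the distances to `t` of adjacent nodes differ by at most one, so any `x` is
-- adjacent to `p i` for at most three consecutive indices `i`.
theorem sum_degree_le_of_dist {d : ℕ} {p : ℕ → V} {t : V} (ht : ∀ i ≤ d, G.Reachable (p i) t)
    (hp : ∀ i ≤ d, G.dist (p i) t = d - i) :
    ∑ i ∈ Finset.range (d + 1), G.degree (p i) ≤ 3 * Fintype.card V := by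
  have h1 : ∀ i, G.degree (p i) = ∑ x, if G.Adj (p i) x then 1 else 0 := by
    intro i
    rw [← G.card_neighborFinset_eq_degree, Finset.card_eq_sum_ones, Finset.sum_ite, Finset.sum_const_zero,
      add_zero]
    congr 1
    ext x
    simp
  simp only [h1]
  rw [Finset.sum_comm, mul_comm, ← smul_eq_mul, ← Finset.card_univ, ← Finset.sum_const]
  refine Finset.sum_le_sum fun x _ => ?_
  rw [← Finset.card_filter]
  have hsub : (Finset.range (d + 1)).filter (fun i => G.Adj (p i) x)
      ⊆ Finset.Icc (d - G.dist x t - 1) (d - G.dist x t + 1) := by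
    intro i hi
    simp only [Finset.mem_filter, Finset.mem_range] at hi
    obtain ⟨hid, hadj⟩ := hi
    have hr := ht i (by omega)
    have hr' : G.Reachable x t := hadj.symm.reachable.trans hr
    obtain ⟨w, hw⟩ := hr.exists_walk_length_eq_dist
    obtain ⟨w', hw'⟩ := hr'.exists_walk_length_eq_dist
    have a1 := SimpleGraph.dist_le (SimpleGraph.Walk.cons hadj w')
    have a2 := SimpleGraph.dist_le (SimpleGraph.Walk.cons hadj.symm w)
    rw [SimpleGraph.Walk.length_cons, hw'] at a1
    rw [SimpleGraph.Walk.length_cons, hw] at a2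
    have := hp i (by omega)
    rw [Finset.mem_Icc]
    omega
  refine (Finset.card_le_card hsub).trans ?_
  rw [Nat.card_Icc]
  omega

theorem mhWeight_one_adj {v u : V} (h : G.Adj v u) :
    mhWeight G (fun _ => 1) v u = (max (G.degree v : ℝ) (G.degree u))⁻¹ := by
  have hv : (0 : ℝ) < G.degree v := by
    exact_mod_cast (G.degree_pos_iff_exists_adj v).2 ⟨u, h⟩
  have hu : (0 : ℝ) < G.degree u := by
    exact_mod_cast (G.degree_pos_iff_exists_adj u).2 ⟨v, h.symm⟩
  rw [mhWeight, if_neg h.ne', if_pos h]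
  rcases le_total (G.degree v : ℝ) (G.degree u) with hle | hle
  · rw [max_eq_right hle, min_eq_right (by gcongr), one_div]
  · rw [max_eq_left hle, min_eq_left (by gcongr), one_div]

theorem mhWeight_one_nonneg (v u : V) : 0 ≤ mhWeight G (fun _ => 1) v u := by
  rw [mhWeight]
  split_ifs
  · have : ∑ x ∈ G.neighborFinset v, min ((1 : ℝ) / G.degree v) (1 / G.degree x)
        ≤ ∑ x ∈ G.neighborFinset v, (1 : ℝ) / G.degree v :=
      Finset.sum_le_sum fun x _ => min_le_left _ _
    rw [Finset.sum_const, G.card_neighborFinset_eq_degree, nsmul_eq_mul, mul_one_div] at this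
    linarith [div_self_le_one (G.degree v : ℝ)]
  · positivity
  · exact le_rfl

theorem mhWeight_one_comm (v u : V) :
    mhWeight G (fun _ => 1) v u = mhWeight G (fun _ => 1) u v := by
  by_cases h : u = v
  · rw [h]
  · simp only [mhWeight, h, Ne.symm h, if_false, G.adj_comm v u, min_comm]

theorem reachable_of_mhWeight_ne_zero {f : V → ℝ} {v u : V} (h : mhWeight G f v u ≠ 0) :
    G.Reachable v u := by
  by_cases h1 : u = v
  · rw [h1]
  · by_cases h2 : G.Adj v u
    · exact h2.reachable
    · simp [mhWeight, h1, h2] at h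

theorem resistance_le {s t : V} (hst : G.Reachable s t) (g : V → ℝ) :
    2 * (g s - g t) ^ 2 ≤ 6 * Fintype.card V *
      ∑ v, ∑ u, mhWeight G (fun _ => 1) v u * (g v - g u) ^ 2 := by
  obtain ⟨w, hw⟩ := hst.exists_walk_length_eq_dist
  set d := w.length with hd
  set p : ℕ → V := w.getVert with hp
  have hreach : ∀ i, G.Reachable (p i) t := fun i => (w.drop i).reachable
  have hdist : ∀ i ≤ d, G.dist (p i) t = d - i := by
    intro i hi
    have a1 := SimpleGraph.dist_le (w.drop i)
    rw [SimpleGraph.Walk.drop_length] at a1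
    obtain ⟨w', hw'⟩ := (hreach i).exists_walk_length_eq_dist
    have a2 := SimpleGraph.dist_le ((w.take i).append w')
    rw [SimpleGraph.Walk.length_append, SimpleGraph.Walk.take_length, hw'] at a2
    have : G.dist (p i) t = G.dist (w.getVert i) t := rfl
    omega
  have hadj : ∀ i < d, G.Adj (p i) (p (i + 1)) := fun i hi => w.adj_getVert_succ hi
  set F : V × V → ℝ := fun x => mhWeight G (fun _ => 1) x.1 x.2 * (g x.1 - g x.2) ^ 2 with hF
  have hF0 : ∀ x, 0 ≤ F x := fun x => mul_nonneg (mhWeight_one_nonneg G _ _) (sq_nonneg _)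
  have hFsymm : ∀ i, F (p (i + 1), p i) = F (p i, p (i + 1)) := fun i => by
    simp only [hF]; rw [mhWeight_one_comm]; ring
  set r : ℕ → ℝ := fun i => max (G.degree (p i) : ℝ) (G.degree (p (i + 1))) with hr
  have hrpos : ∀ i < d, 0 < r i := fun i hi => by
    refine lt_max_of_lt_left ?_
    exact_mod_cast (G.degree_pos_iff_exists_adj _).2 ⟨_, hadj i hi⟩
  have hFr : ∀ i < d, F (p i, p (i + 1)) = (g (p i) - g (p (i + 1))) ^ 2 / r i := fun i hi => by
    simp only [hF, mhWeight_one_adj G (hadj i hi), hr]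
    rw [div_eq_inv_mul]
  -- The maximum is at most the sum of the two degrees, and each path node is an endpoint of at most
  -- two path edges: twice `3n`.
  have hsumr : ∑ i ∈ Finset.range d, r i ≤ 6 * Fintype.card V := by
    have h3 : ∑ i ∈ Finset.range (d + 1), (G.degree (p i) : ℝ) ≤ 3 * Fintype.card V := by
      exact_mod_cast sum_degree_le_of_dist G (fun i _ => hreach i) hdist
    have h4 : ∑ i ∈ Finset.range d, r i ≤
        ∑ i ∈ Finset.range d, (G.degree (p i) : ℝ) + ∑ i ∈ Finset.range d, (G.degree (p (i + 1)) : ℝ) := by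
      rw [← Finset.sum_add_distrib]
      exact Finset.sum_le_sum fun i _ => max_le_add_of_nonneg (by positivity) (by positivity)
    have h5 := Finset.sum_range_succ (fun i => (G.degree (p i) : ℝ)) d
    have h6 := Finset.sum_range_succ' (fun i => (G.degree (p i) : ℝ)) d
    have h7 : (0 : ℝ) ≤ G.degree (p d) := by positivity
    have h8 : (0 : ℝ) ≤ G.degree (p 0) := by positivity
    linarith
  have htel : ∑ i ∈ Finset.range d, (g (p i) - g (p (i + 1))) = g s - g t := by
    rw [Finset.sum_range_sub']
    simp [hp, hd]
  -- Cauchy–Schwarz for resistances in series.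
  have hcs : (g s - g t) ^ 2 ≤ (∑ i ∈ Finset.range d, r i) * ∑ i ∈ Finset.range d, F (p i, p (i + 1)) := by
    rw [← htel]
    refine Finset.sum_sq_le_sum_mul_sum_of_sq_le_mul _ (fun i hi => ?_) (fun i _ => hF0 _)
      fun i hi => ?_
    · exact (hrpos i (Finset.mem_range.1 hi)).le
    · have hi' := Finset.mem_range.1 hi
      rw [hFr i hi', mul_div_cancel₀ _ (hrpos i hi').ne']
  -- The full energy runs over ordered pairs, so every path edge contributes in both orientations;
  -- the distances to `t` show that these `2d` arcs are distinct.
  have henergy : 2 * ∑ i ∈ Finset.range d, F (p i, p (i + 1)) ≤ ∑ x, F x := by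
    set e : ℕ × Bool → V × V := fun x => if x.2 then (p x.1, p (x.1 + 1)) else (p (x.1 + 1), p x.1)
      with he
    have hinj : Set.InjOn e (Finset.range d ×ˢ (Finset.univ : Finset Bool) : Finset (ℕ × Bool)) := by
      rintro ⟨i, a⟩ hi ⟨j, b⟩ hj hij
      simp only [Finset.coe_product, Set.mem_prod, Finset.coe_range, Set.mem_Iio] at hi hj
      have e1 := congrArg (fun x => G.dist x.1 t) hij
      have e2 := congrArg (fun x => G.dist x.2 t) hij
      have i1 := hdist i (by omega)
      have i2 := hdist (i + 1) (by omega)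
      have j1 := hdist j (by omega)
      have j2 := hdist (j + 1) (by omega)
      cases a <;> cases b <;> simp [he, i1, i2, j1, j2] at e1 e2 ⊢ <;> omega
    calc 2 * ∑ i ∈ Finset.range d, F (p i, p (i + 1))
        = ∑ x ∈ Finset.range d ×ˢ (Finset.univ : Finset Bool), F (e x) := by
          rw [Finset.sum_product, Finset.mul_sum]
          refine Finset.sum_congr rfl fun i _ => ?_
          simp only [he, Fintype.sum_bool, if_true, Bool.false_eq_true, if_false, hFsymm]
          ring
      _ = ∑ x ∈ (Finset.range d ×ˢ (Finset.univ : Finset Bool)).image e, F x :=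
          (Finset.sum_image hinj).symm
      _ ≤ ∑ x, F x := Finset.sum_le_sum_of_subset_of_nonneg (Finset.subset_univ _) fun x _ _ => hF0 x
  rw [Fintype.sum_prod_type] at henergy
  have hE : 0 ≤ ∑ i ∈ Finset.range d, F (p i, p (i + 1)) := Finset.sum_nonneg fun i _ => hF0 _
  calc 2 * (g s - g t) ^ 2
      ≤ (∑ i ∈ Finset.range d, r i) * (2 * ∑ i ∈ Finset.range d, F (p i, p (i + 1))) := by linarith
    _ ≤ 6 * Fintype.card V * (2 * ∑ i ∈ Finset.range d, F (p i, p (i + 1))) :=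
        mul_le_mul_of_nonneg_right hsumr (by linarith)
    _ ≤ _ := mul_le_mul_of_nonneg_left henergy (by positivity)

/-- Within `12 n² ⌈log₂ n⌉` steps the walk misses a reachable node with probability at
most `1 / n`. -/
theorem missProb_mhWeight_le {s t : V} (hst : G.Reachable s t) {N : ℕ}
    (hN : 12 * Fintype.card V ^ 2 * Nat.clog 2 (Fintype.card V) ≤ N) :
    missProb (mhWeight G fun _ => 1) t N s ≤ (Fintype.card V : ℝ)⁻¹ := by
  set n := Fintype.card V with hn
  have hn0 : 0 < n := Fintype.card_pos_iff.2 ⟨s⟩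
  have hn' : (0 : ℝ) < n := by exact_mod_cast hn0
  have h0 := mhWeight_one_nonneg G
  have h1 := sum_mhWeight G fun _ => 1
  have hC : ∀ v u, G.Reachable v t → mhWeight G (fun _ => 1) v u ≠ 0 → G.Reachable u t :=
    fun v u hv hK => (reachable_of_mhWeight_ne_zero G hK).symm.trans hv
  have hhalf : ∀ v, G.Reachable v t →
      missProb (mhWeight G fun _ => 1) t (12 * n ^ 2) v ≤ (2 : ℝ)⁻¹ := by
    intro v hv
    have hsum := sum_missProb_le (mhWeight_one_comm G) h0 h1 hC (R := 6 * n) (by positivity)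
      (fun g v hv => resistance_le G hv g) (12 * n ^ 2) hv
    -- Markov's inequality, as monotonicity of the survival probabilities: `12n²` terms with sum at
    -- most `6n²` force the last value down to `1/2`.
    have hlow : (12 * n ^ 2 : ℕ) • missProb (mhWeight G fun _ => 1) t (12 * n ^ 2) v ≤
        ∑ k ∈ Finset.range (12 * n ^ 2), missProb (mhWeight G fun _ => 1) t k v := by
      conv_lhs => rw [← Finset.card_range (12 * n ^ 2)]
      refine Finset.card_nsmul_le_sum _ _ _ fun k hk => ?_
      rw [Finset.card_range]
      exact missProb_antitone h0 h1 v (Finset.mem_range.1 hk).le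
    rw [nsmul_eq_mul] at hlow
    push_cast at hlow
    rw [← hn] at hsum
    have h6 : (0 : ℝ) < 6 * n * n := by positivity
    refine le_of_mul_le_mul_left ?_ h6
    linarith
  refine (missProb_antitone h0 h1 s hN).trans ?_
  change missProb _ _ _ _ ≤ _
  rw [mul_comm]
  refine (missProb_mul_le h0 hC (by norm_num) hhalf _ hst).trans ?_
  rw [inv_pow]
  refine inv_anti₀ hn' ?_
  exact_mod_cast Nat.le_pow_clog one_lt_two n

end Resistance

/-- If the ceiling is `k + 1` then `n ≥ 2^k + 1`, and `e^(k+1) ≤ (2^k + 1)²`. The summand `1` is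
indispensable for `k < 3`; from `k = 3` on already `e^(k+1) ≤ 4^k`. -/
theorem clog_two_le_two_mul_log {n : ℕ} (hn : 0 < n) : (Nat.clog 2 n : ℝ) ≤ 2 * Real.log n := by
  have hn1 : (1 : ℝ) ≤ n := by exact_mod_cast hn
  have hn0 : (0 : ℝ) < n := by linarith
  obtain hk | hk := Nat.eq_zero_or_pos (Nat.clog 2 n)
  · rw [hk]; simpa using Real.log_nonneg hn1
  obtain ⟨k, hk⟩ := Nat.exists_eq_succ_of_ne_zero hk.ne'
  have hlt : 2 ^ k + 1 ≤ n := by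
    refine Nat.succ_le_of_lt ?_
    rw [← Nat.lt_clog_iff_pow_lt one_lt_two]
    omega
  have hlt' : (2 : ℝ) ^ k + 1 ≤ n := by exact_mod_cast hlt
  have he := Real.exp_one_lt_d9
  have he0 := Real.exp_pos 1
  rw [hk]
  have hbase : ∀ j, 3 ≤ j → Real.exp 1 ^ (j + 1) ≤ (2 : ℝ) ^ j * 2 ^ j := by
    intro j hj
    induction j, hj using Nat.le_induction with
    | base => exact (pow_le_pow_left₀ he0.le he.le _).trans (by norm_num)
    | succ j _ ih =>
      calc Real.exp 1 ^ (j + 1 + 1) = Real.exp 1 ^ (j + 1) * Real.exp 1 := pow_succ _ _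
        _ ≤ (2 : ℝ) ^ j * 2 ^ j * 4 := mul_le_mul ih (by linarith) he0.le (by positivity)
        _ = _ := by ring
  suffices h : Real.exp ((k.succ : ℕ) : ℝ) ≤ (n : ℝ) ^ 2 by
    have := Real.log_le_log (Real.exp_pos _) h
    rwa [Real.log_exp, Real.log_pow] at this
  rw [← Real.exp_one_pow]
  refine le_trans ?_ (pow_le_pow_left₀ (by positivity) hlt' 2)
  rcases Nat.lt_or_ge k 3 with h3 | h3
  · refine (pow_le_pow_left₀ he0.le he.le _).trans ?_
    interval_cases k <;> norm_num
  · have := hbase k h3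
    have h2 : (0 : ℝ) < 2 ^ k := by positivity
    change Real.exp 1 ^ (k + 1) ≤ _
    nlinarith

/-! ### From transition matrices to the law of the walk -/

section Hitting

variable {V : Type*} [Fintype V] [DecidableEq V] (G : SimpleGraph V) [DecidableRel G.Adj]

theorem mhStep_one_apply (v u : V) :
    mhStep G (fun _ => 1) (fun _ => one_pos) v u = ENNReal.ofReal (mhWeight G (fun _ => 1) v u) := by
  rw [mhStep, PMF.normalize_apply, tsum_fintype,
    ← ENNReal.ofReal_sum_of_nonneg fun u _ => mhWeight_one_nonneg G v u, sum_mhWeight]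
  simp

theorem unitWalk_succ (N : ℕ) (s : V) :
    unitWalk G (N + 1) s =
      (mhStep G (fun _ => 1) (fun _ => one_pos) s).bind fun b => (unitWalk G N b).map (List.cons s) :=
  rfl

theorem map_mem_unitWalk_false (t : V) (N : ℕ) (v : V) :
    ((unitWalk G N v).map fun p => decide (t ∈ p)) false =
      ENNReal.ofReal (missProb (mhWeight G fun _ => 1) t N v) := by
  induction N generalizing v with
  | zero =>
    simp only [unitWalk, trajectory, PMF.pure_map, PMF.pure_apply, missProb, List.mem_singleton]
    by_cases h : v = t
    · simp [h]
    · simp [h, Ne.symm h]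
  | succ N ih =>
    rw [unitWalk_succ, PMF.map_bind, PMF.bind_apply]
    simp only [PMF.map_comp, missProb]
    by_cases h : v = t
    · subst h
      simp only [if_true, ENNReal.ofReal_zero, ENNReal.tsum_eq_zero, mul_eq_zero]
      intro u
      right
      rw [PMF.apply_eq_zero_iff, PMF.mem_support_map_iff]
      rintro ⟨p, -, hp⟩
      simp at hp
    · rw [if_neg h, tsum_fintype, ENNReal.ofReal_sum_of_nonneg fun u _ =>
        mul_nonneg (mhWeight_one_nonneg G v u) (missProb_nonneg (mhWeight_one_nonneg G) N u)]
      refine Finset.sum_congr rfl fun u _ => ?_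
      rw [ENNReal.ofReal_mul (mhWeight_one_nonneg G v u), ← ih, mhStep_one_apply]
      congr 3
      funext p
      simp [Ne.symm h]

theorem map_mem_unitWalk_false_le {s t : V} (hst : G.Reachable s t) {N : ℕ}
    (hN : 12 * Fintype.card V ^ 2 * Nat.clog 2 (Fintype.card V) ≤ N) :
    ((unitWalk G N s).map fun p => decide (t ∈ p)) false ≤ (Fintype.card V : ℝ≥0∞)⁻¹ := by
  have hn : 0 < Fintype.card V := Fintype.card_pos_iff.2 ⟨s⟩
  rw [map_mem_unitWalk_false]
  refine (ENNReal.ofReal_le_ofReal (missProb_mhWeight_le G hst hN)).trans_eq ?_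
  rw [ENNReal.ofReal_inv_of_pos (by exact_mod_cast hn), ENNReal.ofReal_natCast]

theorem unitWalk_mem_ge {s t : V} (hst : G.Reachable s t) {N : ℕ}
    (hN : 12 * Fintype.card V ^ 2 * Nat.clog 2 (Fintype.card V) ≤ N) :
    1 - (Fintype.card V : ℝ≥0∞)⁻¹ ≤ (unitWalk G N s).toOuterMeasure {p | t ∈ p} := by
  have h1 : (unitWalk G N s).toOuterMeasure {p | t ∈ p}
      = ((unitWalk G N s).map fun p => decide (t ∈ p)) true := by
    rw [← PMF.toOuterMeasure_apply_singleton, PMF.toOuterMeasure_map_apply]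
    congr 1
    ext p
    simp
  have h2 := ((unitWalk G N s).map fun p => decide (t ∈ p)).tsum_coe
  rw [tsum_fintype, Fintype.sum_bool] at h2
  rw [h1, tsub_le_iff_right, ← h2]
  gcongr
  exact map_mem_unitWalk_false_le G hst hN

end Hitting

/-! ### One step of the walk by rejection sampling -/

section Sampling

variable {n : ℕ} (G : SimpleGraph (Fin n)) [DecidableRel G.Adj]
  (port : ∀ v : Fin n, G.neighborSet v ≃ Fin (G.degree v))

theorem degreeQuery_coe (v : Fin n) : degreeQuery G (v : ℕ) = G.degree v := by
  simp [degreeQuery]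

theorem neighborQuery_lt (v : Fin n) (p : ℕ) : neighborQuery G port v p < n := by
  rw [neighborQuery]
  split_ifs
  · exact Fin.is_lt _
  · exact v.pos

/-- The node reached from `v` through port `p`, or node `0` if there is no such port. -/
def neighborFin (v : Fin n) (p : ℕ) : Fin n := ⟨neighborQuery G port v p, neighborQuery_lt G port v p⟩

theorem neighborFin_of_lt (v : Fin n) (p : Fin (G.degree v)) :
    neighborFin G port v p = ((port v).symm p : Fin n) := by
  ext
  simp [neighborFin, neighborQuery]

/-- The law of the result of one round of the Metropolis–Hastings rejection procedure: a uniformly random port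
`p` of `v` is chosen, leading to `u` say, and the walk moves to `u` if a uniformly random number below
`deg u` is less than `deg v`. -/
def roundLaw (v : Fin n) : PMF (Fin n) :=
  (uniformBelow (G.degree v)).bind fun p =>
    (uniformBelow (G.degree (neighborFin G port v p))).map fun r =>
      if 0 < G.degree v - r then neighborFin G port v p else v

/-- Total mass one determines the remaining value. This spares the computation of the loop weight in
`roundLaw_eq`. -/
theorem _root_.PMF.eq_of_forall_ne {α : Type*} {μ ν : PMF α} (a : α) (h : ∀ b, b ≠ a → μ b = ν b) :
    μ = ν := by
  classical
  ext b
  by_cases hb : b = a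
  · subst hb
    have h1 := μ.tsum_coe
    have h2 := ν.tsum_coe
    rw [ENNReal.tsum_eq_add_tsum_ite b] at h1 h2
    have h3 : (∑' x, if x = b then 0 else μ x) = ∑' x, if x = b then 0 else ν x :=
      tsum_congr fun x => by by_cases hx : x = b <;> simp [hx, h]
    rw [h3] at h1
    refine (ENNReal.add_left_inj ?_).1 (h1.trans h2.symm)
    refine ne_top_of_le_ne_top ENNReal.one_ne_top ?_
    rw [← h2]
    exact le_add_self
  · exact h b hb

theorem uniformBelow_apply {d : ℕ} (hd : 0 < d) (x : ℕ) :
    uniformBelow d x = if x < d then (d : ℝ≥0∞)⁻¹ else 0 := by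
  rw [uniformBelow, dif_pos hd]
  exact (PMF.uniformOfFinset_apply ⟨0, Finset.mem_range.2 hd⟩ x).trans (by simp)

theorem uniformBelow_map_apply {α : Type*} [DecidableEq α] {d : ℕ} (hd : 0 < d) (f : ℕ → α) (a : α) :
    ((uniformBelow d).map f) a = ((Finset.range d).filter fun x => f x = a).card / (d : ℝ≥0∞) := by
  rw [PMF.map_apply, tsum_eq_sum (s := Finset.range d)]
  · rw [Finset.card_filter, Nat.cast_sum, div_eq_mul_inv, Finset.sum_mul]
    refine Finset.sum_congr rfl fun x hx => ?_
    rw [uniformBelow_apply hd, if_pos (Finset.mem_range.1 hx)]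
    by_cases h : f x = a
    · simp [h]
    · simp [h, Ne.symm h]
  · intro x hx
    rw [uniformBelow_apply hd, if_neg (fun h => hx (Finset.mem_range.2 h))]
    simp

/-- A neighbour `u` is behind exactly one port, hence proposed with probability `1 / deg v`, and
accepted with probability `min (deg u) (deg v) / deg u`; the product is `1 / max (deg v) (deg u)`.
-/
theorem roundLaw_eq (v : Fin n) : roundLaw G port v = mhStep G (fun _ => 1) (fun _ => one_pos) v := by
  refine PMF.eq_of_forall_ne v fun u huv => ?_
  rw [mhStep_one_apply, roundLaw, PMF.bind_apply]
  by_cases hadj : G.Adj v u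
  · have hv : 0 < G.degree v := (G.degree_pos_iff_exists_adj v).2 ⟨u, hadj⟩
    have hu : 0 < G.degree u := (G.degree_pos_iff_exists_adj u).2 ⟨v, hadj.symm⟩
    set q : Fin (G.degree v) := port v ⟨u, hadj⟩ with hq
    have hqu : neighborFin G port v q = u := by rw [neighborFin_of_lt, hq]; simp
    rw [tsum_eq_single (q : ℕ)]
    · rw [hqu, uniformBelow_apply hv, if_pos q.is_lt, uniformBelow_map_apply hu,
        mhWeight_one_adj G hadj]
      have hfil : ((Finset.range (G.degree u)).filter
          fun r => (if 0 < G.degree v - r then u else v) = u) =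
          Finset.range (min (G.degree u) (G.degree v)) := by
        ext r
        by_cases hr : 0 < G.degree v - r
        · rw [Finset.mem_filter, if_pos hr, Finset.mem_range, Finset.mem_range]; omega
        · rw [Finset.mem_filter, if_neg hr, Finset.mem_range, Finset.mem_range]
          have := huv.symm
          simp only [this, and_false, false_iff]; omega
      rw [hfil, Finset.card_range]
      have hv' : (0 : ℝ) < G.degree v := by exact_mod_cast hv
      have hu' : (0 : ℝ) < G.degree u := by exact_mod_cast hu
      rw [← ENNReal.ofReal_natCast (G.degree v), ← ENNReal.ofReal_natCast (G.degree u),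
        ← ENNReal.ofReal_natCast (min _ _), ← ENNReal.ofReal_inv_of_pos hv',
        ← ENNReal.ofReal_div_of_pos hu', ← ENNReal.ofReal_mul (by positivity)]
      congr 1
      push_cast
      rcases le_total (G.degree v : ℝ) (G.degree u) with h | h
      · rw [min_eq_right h, max_eq_right h]; field_simp
      · rw [min_eq_left h, max_eq_left h]; field_simp
    · intro p hp
      by_cases hpd : p < G.degree v
      · have hne : neighborFin G port v p ≠ u := by
          intro hpu
          have := neighborFin_of_lt G port v ⟨p, hpd⟩
          rw [hpu] at this
          refine hp ?_
          have h2 : (port v).symm ⟨p, hpd⟩ = ⟨u, hadj⟩ := Subtype.ext this.symm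
          rw [hq, ← h2]
          simp
        rw [mul_eq_zero]
        right
        rw [PMF.apply_eq_zero_iff, PMF.mem_support_map_iff]
        rintro ⟨r, -, hr⟩
        split_ifs at hr
        · exact hne hr
        · exact huv hr.symm
      · rw [uniformBelow_apply hv, if_neg hpd, zero_mul]
  · rw [mhWeight, if_neg huv, if_neg hadj, ENNReal.ofReal_zero, ENNReal.tsum_eq_zero]
    intro p
    rw [mul_eq_zero]
    by_cases hpd : p < G.degree v
    · right
      rw [PMF.apply_eq_zero_iff, PMF.mem_support_map_iff]
      rintro ⟨r, -, hr⟩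
      split_ifs at hr
      · rw [neighborFin_of_lt G port v ⟨p, hpd⟩] at hr
        exact hadj (hr ▸ ((port v).symm ⟨p, hpd⟩).2)
      · exact huv hr.symm
    -- At an isolated node the default answers of the queries propose node `0`, but the test `0 < 0
    -- - r` always fails, so the walk stays put.
    · rcases Nat.eq_zero_or_pos (G.degree v) with h0 | h0
      · right
        rw [PMF.apply_eq_zero_iff, PMF.mem_support_map_iff]
        rintro ⟨r, -, hr⟩
        simp only [h0, Nat.zero_sub, lt_irrefl, if_false] at hr
        exact huv hr.symm
      · left
        rw [uniformBelow_apply h0, if_neg hpd]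

end Sampling

theorem _root_.PMF.bind_congr {α β : Type*} {μ : PMF α} {f g : α → PMF β}
    (h : ∀ a ∈ μ.support, f a = g a) : μ.bind f = μ.bind g := by
  ext b
  rw [PMF.bind_apply, PMF.bind_apply]
  refine tsum_congr fun a => ?_
  by_cases ha : μ a = 0
  · simp [ha]
  · rw [h a ((PMF.mem_support_iff _ _).2 ha)]

theorem _root_.PMF.map_congr {α β : Type*} {μ : PMF α} {f g : α → β}
    (h : ∀ a ∈ μ.support, f a = g a) : μ.map f = μ.map g :=
  PMF.bind_congr fun a ha => congrArg PMF.pure (h a ha)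

/-! ### Symbolic execution of programs -/

section Observation

/-- The configuration at line `l` with the contents `xs` of the first registers. -/
def cfg (l : ℕ) (xs : List ℕ) : Config := ⟨l, xs.toFinsupp⟩

@[simp]
theorem cfg_mem (l : ℕ) (xs : List ℕ) (i : ℕ) : (cfg l xs).mem i = xs.getD i 0 := rfl

theorem cfg_write (l : ℕ) {xs : List ℕ} {i : ℕ} (hi : i < xs.length) (x : ℕ) :
    (cfg l xs).write i x = cfg (l + 1) (xs.set i x) := by
  simp only [cfg, Config.write, Config.mk.injEq, true_and]
  ext j
  simp only [Finsupp.coe_update, List.toFinsupp_apply, Function.update_apply, List.getD_eq_getElem?_getD,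
    List.getElem?_set]
  by_cases hj : j = i
  · simp [hj, hi]
  · simp [hj, Ne.symm hj]

/-- Twelve registers are in use, with contents less than `W`. -/
def Config.Bounded (W : ℕ) (c : Config) : Prop :=
  ∃ xs : List ℕ, xs.length = 12 ∧ (∀ x ∈ xs, x < W) ∧ c.mem = xs.toFinsupp

theorem Config.Bounded.space_le {c : Config} {e : ℕ} (h : c.Bounded (2 ^ e)) :
    c.space ≤ 12 * (4 + e) := by
  obtain ⟨xs, hlen, hlt, hc⟩ := h
  rw [Config.space, hc, Finsupp.sum]
  have hsub : xs.toFinsupp.support ⊆ Finset.range 12 := hlen ▸ List.toFinsupp_support_subset xs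
  calc _ ≤ ∑ _i ∈ xs.toFinsupp.support, (4 + e) := by
        refine Finset.sum_le_sum fun i hi => add_le_add ?_ ?_
        · have := Finset.mem_range.1 (hsub hi)
          exact Nat.size_le.2 (by omega)
        · have hi' : i < xs.length := hlen ▸ Finset.mem_range.1 (hsub hi)
          rw [List.toFinsupp_apply_lt xs i hi']
          exact Nat.size_le.2 (hlt _ (List.getElem_mem hi'))
    _ = xs.toFinsupp.support.card * (4 + e) := by simp
    _ ≤ 12 * (4 + e) := by
        gcongr
        simpa using Finset.card_le_card hsub

variable {n : ℕ} (G : SimpleGraph (Fin n)) [DecidableRel G.Adj]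
  (port : ∀ v : Fin n, G.neighborSet v ≃ Fin (G.degree v)) (P : Program) (l r W : ℕ)

/-- What is of interest in a finite sequence of configurations: the contents of register `r` at line
`l`, the final answer, and whether the registers stay bounded. -/
def view (τ : List Config) : List ℕ × Option Bool × Prop :=
  (record l r τ, answer P τ, ∀ c ∈ τ, c.Bounded W)

/-- The law of the view of the first `k` steps from the configuration `c`. -/
def obs (k : ℕ) (c : Config) : PMF (List ℕ × Option Bool × Prop) :=
  (trajectory (step G port P) k c).map (view P l r W)

theorem ne_nil_of_mem_trajectory {α : Type*} {K : α → PMF α} {k : ℕ} {a : α} {τ : List α}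
    (h : τ ∈ (trajectory K k a).support) : τ ≠ [] := by
  cases k with
  | zero => simp [trajectory] at h; simp [h]
  | succ k =>
    simp only [trajectory, PMF.mem_support_bind_iff, PMF.mem_support_map_iff] at h
    obtain ⟨_, _, _, _, rfl⟩ := h
    simp

variable {W}

/-- Prepending a configuration to a nonempty run leaves the final answer alone, adds at most one
entry to the record, and keeps the boundedness clause because of `hW`. -/
theorem obs_succ {c : Config} (hW : c.Bounded W) (k : ℕ) :
    obs G port P l r W (k + 1) c = (step G port P c).bind fun b =>
      (obs G port P l r W k b).map fun y => (if c.line = l then c.mem r :: y.1 else y.1, y.2) := by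
  rw [obs, trajectory, PMF.map_bind]
  refine PMF.bind_congr fun b _ => ?_
  rw [obs, PMF.map_comp, PMF.map_comp]
  refine PMF.map_congr fun τ hτ => ?_
  have hne := ne_nil_of_mem_trajectory hτ
  obtain ⟨d, τ', rfl⟩ := List.exists_cons_of_ne_nil hne
  simp only [view, Function.comp_apply, List.forall_mem_cons (a := c), hW, true_and, Prod.mk.injEq,
    and_true]
  refine ⟨?_, ?_⟩
  · by_cases hl : c.line = l
    · simp [record, hl]
    · simp [record, hl]
  · simp [answer]

variable {l}

theorem obs_succ_of_ne {c : Config} (hW : c.Bounded W) (hl : c.line ≠ l) (k : ℕ) :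
    obs G port P l r W (k + 1) c = (step G port P c).bind (obs G port P l r W k) := by
  rw [obs_succ G port P l r hW]
  simp only [hl, if_false, Prod.mk.eta]
  refine PMF.bind_congr fun b _ => PMF.map_id _

/-- A halting configuration is a fixed point of `step`, so the remaining number of steps is
irrelevant. -/
theorem obs_of_halt {c : Config} (hW : c.Bounded W) (hl : c.line ≠ l) {b : Bool}
    (hb : P[c.line]? = some (if b then .accept else .reject)) (k : ℕ) :
    obs G port P l r W k c = PMF.pure ([], some b, True) := by
  have hstep : step G port P c = PMF.pure c := by
    cases b <;> simp [step, hb]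
  induction k with
  | zero =>
    rw [obs, trajectory, PMF.pure_map]
    cases b <;> simp [view, record, hl, answer, Config.answer, hb, hW]
  | succ k ih => rw [obs_succ_of_ne G port P r hW hl, hstep, PMF.pure_bind, ih]

variable {P}

theorem bounded_cfg {xs : List ℕ} {line : ℕ} (hx : xs.length = 12 ∧ ∀ x ∈ xs, x < W) :
    (cfg line xs).Bounded W := ⟨xs, hx.1, hx.2, rfl⟩

variable {line k : ℕ} {xs : List ℕ} (hl : line ≠ l) (hx : xs.length = 12 ∧ ∀ x ∈ xs, x < W)
include hl hx

theorem obs_const {i m : ℕ} (hP : P[line]? = some (.const i m)) (hi : i < 12) :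
    obs G port P l r W (k + 1) (cfg line xs) = obs G port P l r W k (cfg (line + 1) (xs.set i m)) := by
  rw [obs_succ_of_ne G port P r (bounded_cfg hx) hl, ← cfg_write _ (hx.1 ▸ hi)]
  simp [step, show P[(cfg line xs).line]? = _ from hP]

theorem obs_add {i a b : ℕ} (hP : P[line]? = some (.add i a b)) (hi : i < 12) :
    obs G port P l r W (k + 1) (cfg line xs) =
      obs G port P l r W k (cfg (line + 1) (xs.set i (xs.getD a 0 + xs.getD b 0))) := by
  rw [obs_succ_of_ne G port P r (bounded_cfg hx) hl, ← cfg_write _ (hx.1 ▸ hi)]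
  simp [step, show P[(cfg line xs).line]? = _ from hP]

theorem obs_sub {i a b : ℕ} (hP : P[line]? = some (.sub i a b)) (hi : i < 12) :
    obs G port P l r W (k + 1) (cfg line xs) =
      obs G port P l r W k (cfg (line + 1) (xs.set i (xs.getD a 0 - xs.getD b 0))) := by
  rw [obs_succ_of_ne G port P r (bounded_cfg hx) hl, ← cfg_write _ (hx.1 ▸ hi)]
  simp [step, show P[(cfg line xs).line]? = _ from hP]

theorem obs_degree {i a : ℕ} (hP : P[line]? = some (.degree i a)) (hi : i < 12) :
    obs G port P l r W (k + 1) (cfg line xs) =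
      obs G port P l r W k (cfg (line + 1) (xs.set i (degreeQuery G (xs.getD a 0)))) := by
  rw [obs_succ_of_ne G port P r (bounded_cfg hx) hl, ← cfg_write _ (hx.1 ▸ hi)]
  simp [step, show P[(cfg line xs).line]? = _ from hP]

theorem obs_neighbor {i a b : ℕ} (hP : P[line]? = some (.neighbor i a b)) (hi : i < 12) :
    obs G port P l r W (k + 1) (cfg line xs) = obs G port P l r W k
      (cfg (line + 1) (xs.set i (neighborQuery G port (xs.getD a 0) (xs.getD b 0)))) := by
  rw [obs_succ_of_ne G port P r (bounded_cfg hx) hl, ← cfg_write _ (hx.1 ▸ hi)]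
  simp [step, show P[(cfg line xs).line]? = _ from hP]

theorem obs_random {i a : ℕ} (hP : P[line]? = some (.random i a)) (hi : i < 12) :
    obs G port P l r W (k + 1) (cfg line xs) = (uniformBelow (xs.getD a 0)).bind fun x =>
      obs G port P l r W k (cfg (line + 1) (xs.set i x)) := by
  rw [obs_succ_of_ne G port P r (bounded_cfg hx) hl]
  simp only [← cfg_write _ (hx.1.symm ▸ hi)]
  simp only [step, show P[(cfg line xs).line]? = _ from hP, PMF.bind_map]
  rfl

theorem obs_jumpPos {a m : ℕ} (hP : P[line]? = some (.jumpPos a m)) :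
    obs G port P l r W (k + 1) (cfg line xs) =
      obs G port P l r W k (cfg (if 0 < xs.getD a 0 then m else line + 1) xs) := by
  rw [obs_succ_of_ne G port P r (bounded_cfg hx) hl]
  simp only [step, show P[(cfg line xs).line]? = _ from hP, PMF.pure_bind]
  rfl

omit hl in
theorem obs_sub_record {i a b : ℕ} (hP : P[line]? = some (.sub i a b)) (hi : i < 12) :
    obs G port P line r W (k + 1) (cfg line xs) =
      (obs G port P line r W k (cfg (line + 1) (xs.set i (xs.getD a 0 - xs.getD b 0)))).map
        fun y => (xs.getD r 0 :: y.1, y.2) := by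
  rw [obs_succ G port P line r (bounded_cfg hx), ← cfg_write _ (hx.1 ▸ hi)]
  simp only [step, show P[(cfg line xs).line]? = _ from hP, PMF.pure_bind]
  simp [cfg]

end Observation

/-! ### The program and the law of its runs -/

/-- The program for USTCON. Register `0` holds `n`, `1` the current node of the walk, `2` the target `t`,
`3` the number `24 n²`, `5` the number of steps still to be made, `7` the number `1`, `8` the number of
visits to `t`, and `11` the number `0`; the others are for intermediate results. Lines `0` to `15` compute
the number of steps, line `16` begins a round of the walk, and lines `22` and `23` give the answer. -/
def walkProgram : Program :=
  [.const 7 1, .add 4 0 11,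
   .add 3 3 0, .sub 4 4 7, .jumpPos 4 2,
   .add 3 3 3, .add 3 3 3, .add 3 3 3, .add 6 3 3, .add 3 3 6,
   .const 4 1, .jumpPos 7 14,
   .add 5 5 3, .add 4 4 4, .sub 6 0 4, .jumpPos 6 12,
   .sub 6 1 2, .sub 9 2 1, .add 6 6 9, .sub 6 7 6, .add 8 8 6, .jumpPos 5 24,
   .jumpPos 8 36, .reject,
   .sub 5 5 7, .degree 6 1, .random 9 6, .neighbor 9 1 9, .degree 10 9, .random 10 10, .sub 6 6 10,
   .jumpPos 6 34, .add 1 1 11, .jumpPos 7 16, .add 1 9 11, .jumpPos 7 16,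
   .accept]

theorem le_of_mem_uniformBelow_support {d x : ℕ} (h : x ∈ (uniformBelow d).support) : x ≤ d := by
  rw [PMF.mem_support_iff] at h
  rcases Nat.eq_zero_or_pos d with rfl | hd
  · simp [uniformBelow] at h
    omega
  · rw [uniformBelow_apply hd] at h
    by_contra hx
    exact h (if_neg (by omega))

variable {n : ℕ} (G : SimpleGraph (Fin n)) [DecidableRel G.Adj]
  (port : ∀ v : Fin n, G.neighborSet v ≃ Fin (G.degree v)) {W : ℕ}

/-- The law of what is of interest in a run of the program. -/
abbrev walkObs (W k line : ℕ) (xs : List ℕ) : PMF (List ℕ × Option Bool × Prop) :=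
  obs G port walkProgram 16 1 W k (cfg line xs)

/-- Multiplication by repeated addition, three instructions per pass. The loop tests its counter
after the body, so the counter has to start positive. -/
theorem walkObs_square {v t i a : ℕ} (k : ℕ) (hn : n < W) (hv : v < W) (ht : t < W) (h1 : 1 < W)
    (hi : i + 1 < W) (ha : a + n * (i + 1) < W) :
    walkObs G port W (k + 3 * (i + 1)) 2 [n, v, t, a, i + 1, 0, 0, 1, 0, 0, 0, 0] =
      walkObs G port W k 5 [n, v, t, a + n * (i + 1), 0, 0, 0, 1, 0, 0, 0, 0] := by
  induction i generalizing a with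
  | zero =>
    rw [zero_add, mul_one] at ha ⊢
    rw [walkObs, show k + 3 * 1 = k + 2 + 1 by ring]
    rw [obs_add G port 1 (by norm_num) (by simp; omega) rfl (by norm_num)]
    simp only [List.set, List.getD_cons_succ, List.getD_cons_zero, Nat.reduceAdd]
    rw [obs_sub G port 1 (by norm_num) (by simp; omega) rfl (by norm_num)]
    simp only [List.set, List.getD_cons_succ, List.getD_cons_zero, Nat.reduceAdd]
    rw [obs_jumpPos G port 1 (by norm_num) (by simp; omega) rfl]
    simp
  | succ i ih =>
    have h2 : a + n * (i + 1 + 1) = a + n + n * (i + 1) := by ring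
    rw [h2] at ha ⊢
    rw [← ih (by omega) ha]
    rw [walkObs, show k + 3 * (i + 1 + 1) = k + 3 * (i + 1) + 2 + 1 by ring]
    rw [obs_add G port 1 (by norm_num) (by simp; omega) rfl (by norm_num)]
    simp only [List.set, List.getD_cons_succ, List.getD_cons_zero, Nat.reduceAdd]
    rw [obs_sub G port 1 (by norm_num) (by simp; omega) rfl (by norm_num)]
    simp only [List.set, List.getD_cons_succ, List.getD_cons_zero, Nat.reduceAdd]
    rw [obs_jumpPos G port 1 (by norm_num) (by simp; omega) rfl]
    simp

/-- Register `4` is doubled until it is at least `n`, and register `5` gains `A` in each pass; the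
number of passes is the rounded-up logarithm. Here the test comes first, so `n = 1` gives no pass.
-/
theorem walkObs_clog {v t A x6 c : ℕ} (hc : c = Nat.clog 2 n) (k : ℕ) (hn : n < W) (hv : v < W)
    (ht : t < W) (h1 : 1 < W) (hA : A < W) (hx : x6 < W) (hp : 2 ^ c < W) (hN : A * c < W) (m i : ℕ)
    (him : i + m = c) :
    walkObs G port W (k + 4 * m + 2) 14 [n, v, t, A, 2 ^ i, A * i, x6, 1, 0, 0, 0, 0] =
      walkObs G port W k 16 [n, v, t, A, 2 ^ c, A * c, 0, 1, 0, 0, 0, 0] := by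
  induction m generalizing i x6 with
  | zero =>
    rw [add_zero] at him
    subst him
    have hle : n ≤ 2 ^ i := by
      rw [← Nat.clog_le_iff_le_pow one_lt_two, hc]
    have h0 : n - 2 ^ i = 0 := by omega
    rw [walkObs, mul_zero, add_zero]
    rw [obs_sub G port 1 (by norm_num) (by simp; omega) rfl (by norm_num)]
    simp only [List.set, List.getD_cons_succ, List.getD_cons_zero, Nat.reduceAdd]
    rw [obs_jumpPos G port 1 (by norm_num) (by simp; omega) rfl]
    simp [h0]
  | succ m ih =>
    have hlt : 2 ^ i < n := by
      rw [← Nat.lt_clog_iff_pow_lt one_lt_two, ← hc]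
      omega
    have hpos : 0 < n - 2 ^ i := by omega
    have h0 : 0 < 2 ^ i := by positivity
    have h2 : 2 ^ (i + 1) = 2 ^ i + 2 ^ i := by ring
    have h3 : A * (i + 1) = A * i + A := by ring
    have h4 : 2 ^ i + 2 ^ i ≤ 2 ^ c := h2 ▸ Nat.pow_le_pow_right (by norm_num) (by omega)
    have h5 : A * i + A ≤ A * c := h3 ▸ Nat.mul_le_mul_left A (by omega)
    rw [← ih (x6 := n - 2 ^ i) (by omega) (i + 1) (by omega)]
    rw [walkObs, show k + 4 * (m + 1) + 2 = k + 4 * m + 2 + 3 + 1 by ring]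
    rw [obs_sub G port 1 (by norm_num) (by simp; omega) rfl (by norm_num)]
    simp only [List.set, List.getD_cons_succ, List.getD_cons_zero, Nat.reduceAdd]
    rw [obs_jumpPos G port 1 (by norm_num) (by simp; omega) rfl]
    simp only [List.getD_cons_succ, List.getD_cons_zero, hpos, if_true]
    rw [obs_add G port 1 (by norm_num) (by simp; omega) rfl (by norm_num)]
    simp only [List.set, List.getD_cons_succ, List.getD_cons_zero, Nat.reduceAdd]
    rw [obs_add G port 1 (by norm_num) (by simp; omega) rfl (by norm_num)]
    simp only [List.set, List.getD_cons_succ, List.getD_cons_zero, Nat.reduceAdd]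
    rw [h2, h3]

/-- The test whether the current node is the target. -/
theorem walkObs_test {v t A p j f x6 x9 x10 : ℕ} (k : ℕ) (hn : n < W) (hv : v < n) (ht : t < n)
    (h1 : 1 < W) (hA : A < W) (hp : p < W) (hf : f + j + 1 < W) (hx6 : x6 < W) (hx9 : x9 < W)
    (hx10 : x10 < W) :
    ∃ y6 y9, y6 < W ∧ y9 < W ∧
    walkObs G port W (k + 5) 16 [n, v, t, A, p, j, x6, 1, f, x9, x10, 0] =
      (walkObs G port W k 21 [n, v, t, A, p, j, y6, 1, f + (if v = t then 1 else 0), y9, x10, 0]).map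
        fun y => (v :: y.1, y.2) := by
  -- The two truncated differences add up to `|v - t|`.
  have h6 : 1 - (v - t + (t - v)) = if v = t then 1 else 0 := by
    split_ifs <;> omega
  refine ⟨1 - (v - t + (t - v)), t - v, by omega, by omega, ?_⟩
  rw [walkObs]
  rw [obs_sub_record G port 1 (by simp; omega) rfl (by norm_num)]
  simp only [List.set, List.getD_cons_succ, List.getD_cons_zero, Nat.reduceAdd]
  rw [obs_sub G port 1 (by norm_num) (by simp; omega) rfl (by norm_num)]
  simp only [List.set, List.getD_cons_succ, List.getD_cons_zero, Nat.reduceAdd]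
  rw [obs_add G port 1 (by norm_num) (by simp; omega) rfl (by norm_num)]
  simp only [List.set, List.getD_cons_succ, List.getD_cons_zero, Nat.reduceAdd]
  rw [obs_sub G port 1 (by norm_num) (by simp; omega) rfl (by norm_num)]
  simp only [List.set, List.getD_cons_succ, List.getD_cons_zero, Nat.reduceAdd]
  rw [obs_add G port 1 (by norm_num) (by simp; omega) rfl (by norm_num)]
  simp only [List.set, List.getD_cons_succ, List.getD_cons_zero, Nat.reduceAdd, ← h6]

theorem walkObs_answer {v t A p f x6 x9 x10 : ℕ} (k : ℕ) (hn : n < W) (hv : v < W) (ht : t < W)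
    (h1 : 1 < W) (hA : A < W) (hp : p < W) (hf : f < W) (hx6 : x6 < W) (hx9 : x9 < W)
    (hx10 : x10 < W) :
    walkObs G port W (k + 2) 21 [n, v, t, A, p, 0, x6, 1, f, x9, x10, 0] =
      PMF.pure ([], some (decide (0 < f)), True) := by
  rw [walkObs]
  rw [obs_jumpPos G port 1 (by norm_num) (by simp; omega) rfl]
  simp only [List.getD_cons_succ, List.getD_cons_zero, lt_irrefl, if_false, Nat.reduceAdd]
  rw [obs_jumpPos G port 1 (by norm_num) (by simp; omega) rfl]
  simp only [List.getD_cons_succ, List.getD_cons_zero, Nat.reduceAdd]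
  have hx : [n, v, t, A, p, 0, x6, 1, f, x9, x10, 0].length = 12 ∧
      ∀ x ∈ [n, v, t, A, p, 0, x6, 1, f, x9, x10, 0], x < W := by simp; omega
  by_cases h : 0 < f
  · simp only [h, if_true, decide_true]
    exact obs_of_halt G port _ 1 (bounded_cfg hx) (by norm_num [cfg]) rfl k
  · simp only [h, if_false, decide_false]
    exact obs_of_halt G port _ 1 (bounded_cfg hx) (by norm_num [cfg]) rfl k

/-- One step of the walk. -/
theorem walkObs_move {t A p j f x6 x9 x10 : ℕ} (v : Fin n) (k : ℕ) (hn : n < W) (ht : t < W)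
    (h1 : 1 < W) (hA : A < W) (hp : p < W) (hj : j + 1 < W) (hf : f < W) (hx6 : x6 < W)
    (hx9 : x9 < W) (hx10 : x10 < W) {F : Fin n → PMF (List ℕ × Option Bool × Prop)}
    (hF : ∀ (u : Fin n) (y6 y9 y10 : ℕ), y6 < W → y9 < W → y10 < W →
      walkObs G port W k 16 [n, u, t, A, p, j, y6, 1, f, y9, y10, 0] = F u) :
    walkObs G port W (k + 11) 21 [n, v, t, A, p, j + 1, x6, 1, f, x9, x10, 0] =
      (mhStep G (fun _ => 1) (fun _ => one_pos) v).bind F := by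
  have hv := v.is_lt
  have hdeg : ∀ u : Fin n, G.degree u < n := fun u => by
    simpa using G.degree_lt_card_verts u
  have hdv := hdeg v
  rw [walkObs, ← roundLaw_eq G port, roundLaw, PMF.bind_bind]
  rw [obs_jumpPos G port 1 (by norm_num) (by simp; omega) rfl]
  simp only [List.getD_cons_succ, List.getD_cons_zero, Nat.succ_pos, if_true]
  rw [obs_sub G port 1 (by norm_num) (by simp; omega) rfl (by norm_num)]
  simp only [List.set, List.getD_cons_succ, List.getD_cons_zero, Nat.reduceAdd, Nat.add_sub_cancel]
  rw [obs_degree G port 1 (by norm_num) (by simp; omega) rfl (by norm_num)]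
  simp only [List.set, List.getD_cons_succ, List.getD_cons_zero, Nat.reduceAdd, degreeQuery_coe]
  rw [obs_random G port 1 (by norm_num) (by simp; omega) rfl (by norm_num)]
  simp only [List.set, List.getD_cons_succ, List.getD_cons_zero, Nat.reduceAdd]
  refine PMF.bind_congr fun q hq => ?_
  have hq' := le_of_mem_uniformBelow_support hq
  rw [obs_neighbor G port 1 (by norm_num) (by simp; omega) rfl (by norm_num)]
  simp only [List.set, List.getD_cons_succ, List.getD_cons_zero, Nat.reduceAdd]
  obtain ⟨u, hu⟩ : ∃ u, u = neighborFin G port v q := ⟨_, rfl⟩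
  have hun := u.is_lt
  have hdu := hdeg u
  rw [show neighborQuery G port v q = (u : ℕ) by rw [hu]; rfl, ← hu]
  rw [obs_degree G port 1 (by norm_num) (by simp; omega) rfl (by norm_num)]
  simp only [List.set, List.getD_cons_succ, List.getD_cons_zero, Nat.reduceAdd, degreeQuery_coe]
  rw [obs_random G port 1 (by norm_num) (by simp; omega) rfl (by norm_num)]
  simp only [List.set, List.getD_cons_succ, List.getD_cons_zero, Nat.reduceAdd]
  rw [PMF.bind_map]
  refine PMF.bind_congr fun r hr => ?_
  have hr' := le_of_mem_uniformBelow_support hr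
  rw [Function.comp_apply]
  rw [obs_sub G port 1 (by norm_num) (by simp; omega) rfl (by norm_num)]
  simp only [List.set, List.getD_cons_succ, List.getD_cons_zero, Nat.reduceAdd]
  rw [obs_jumpPos G port 1 (by norm_num) (by simp; omega) rfl]
  simp only [List.getD_cons_succ, List.getD_cons_zero, Nat.reduceAdd]
  -- Acceptance and rejection take equally many instructions, so the length of a round does not
  -- depend on the random choices.
  by_cases h : 0 < G.degree v - r
  · simp only [h, if_true]
    rw [obs_add G port 1 (by norm_num) (by simp; omega) rfl (by norm_num)]
    simp only [List.set, List.getD_cons_succ, List.getD_cons_zero, Nat.reduceAdd, add_zero]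
    rw [obs_jumpPos G port 1 (by norm_num) (by simp; omega) rfl]
    simp only [List.getD_cons_succ, List.getD_cons_zero, one_pos, if_true]
    exact hF u _ _ _ (by omega) (by omega) (by omega)
  · simp only [h, if_false]
    rw [obs_add G port 1 (by norm_num) (by simp; omega) rfl (by norm_num)]
    simp only [List.set, List.getD_cons_succ, List.getD_cons_zero, Nat.reduceAdd, add_zero]
    rw [obs_jumpPos G port 1 (by norm_num) (by simp; omega) rfl]
    simp only [List.getD_cons_succ, List.getD_cons_zero, one_pos, if_true]
    exact hF v _ _ _ (by omega) (by omega) (by omega)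

/-- Induction on the steps still to be made, for an arbitrary number `f` of earlier visits to `t`. A
test costs 5 instructions, a move 11 and the answer 2, whence `16 * j + 7`; the hypothesis on `f + j
+ 1` leaves room for a visit at each of the remaining times. -/
theorem walkObs_walk (t : Fin n) {A p : ℕ} (hn : n < W) (h1 : 1 < W) (hA : A < W) (hp : p < W)
    (j : ℕ) (v : Fin n) {f x6 x9 x10 : ℕ} (hf : f + j + 1 < W) (hx6 : x6 < W) (hx9 : x9 < W)
    (hx10 : x10 < W) :
    walkObs G port W (16 * j + 7) 16 [n, v, t, A, p, j, x6, 1, f, x9, x10, 0] =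
      (unitWalk G j v).map fun q => (q.map Fin.val, some (decide (t ∈ q ∨ 0 < f)), True) := by
  induction j generalizing v f x6 x9 x10 with
  | zero =>
    obtain ⟨y6, y9, h6, h9, h⟩ := walkObs_test G port (A := A) (p := p) (x6 := x6) (x9 := x9) (x10 := x10)
      (j := 0) 2 hn v.is_lt t.is_lt h1 hA hp hf hx6 hx9 hx10
    rw [mul_zero, zero_add, h, ← zero_add 2, walkObs_answer G port 0 hn (v.is_lt.trans hn)
      (t.is_lt.trans hn) h1 hA hp (by split_ifs <;> omega) h6 h9 hx10]
    simp only [unitWalk, trajectory, PMF.pure_map]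
    by_cases hvt : v = t
    · simp [hvt]
    · simp [hvt, Fin.val_inj, Ne.symm hvt]
  | succ j ih =>
    obtain ⟨y6, y9, h6, h9, h⟩ := walkObs_test G port (A := A) (p := p) (x6 := x6) (x9 := x9) (x10 := x10)
      (16 * j + 7 + 11) hn v.is_lt t.is_lt h1 hA hp hf hx6 hx9 hx10
    rw [show 16 * (j + 1) + 7 = 16 * j + 7 + 11 + 5 by ring, h,
      walkObs_move G port v (16 * j + 7) hn (t.is_lt.trans hn) h1 hA hp (by omega)
        (by split_ifs <;> omega) h6 h9 hx10 fun u z6 z9 z10 hz6 hz9 hz10 =>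
          ih u (by split_ifs <;> omega) hz6 hz9 hz10,
      unitWalk_succ, PMF.map_bind, PMF.map_bind]
    congr 1
    funext u
    rw [PMF.map_comp, PMF.map_comp]
    congr 1
    funext q
    by_cases hvt : v = t
    · simp [hvt]
    · simp [hvt, Fin.val_inj, Ne.symm hvt]

theorem init_eq_cfg (s t : Fin n) : Config.init s t = cfg 0 [n, s, t, 0, 0, 0, 0, 0, 0, 0, 0, 0] := by
  simp only [Config.init, cfg, Config.mk.injEq, true_and]
  ext j
  rcases j with _ | _ | _ | j
  · simp
  · simp
  · simp
  · simp only [Finsupp.add_apply, List.toFinsupp_apply, List.getD_cons_succ]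
    rw [Finsupp.single_eq_of_ne (by omega), Finsupp.single_eq_of_ne (by omega),
      Finsupp.single_eq_of_ne (by omega)]
    rcases j with _ | _ | _ | _ | _ | _ | _ | _ | _ | j <;> simp

/-! ### Time and space bounds -/

/-- The running time of the program. -/
def walkTime (n : ℕ) : ℕ :=
  16 * (24 * n ^ 2 * Nat.clog 2 n) + 7 + 4 * Nat.clog 2 n + 2 + 7 + 3 * n + 2

theorem walkObs_init (s t : Fin n) (h1 : 1 < W) (hn : n < W) (hA : 24 * n ^ 2 < W)
    (hp : 2 ^ Nat.clog 2 n < W) (hN : 24 * n ^ 2 * Nat.clog 2 n + 1 < W) :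
    obs G port walkProgram 16 1 W (walkTime n) (Config.init s t) =
      (unitWalk G (24 * n ^ 2 * Nat.clog 2 n) s).map fun q =>
        (q.map Fin.val, some (decide (t ∈ q)), True) := by
  have hs := s.is_lt
  have ht := t.is_lt
  rw [init_eq_cfg, walkTime]
  rw [obs_const G port 1 (by norm_num) (by simp; omega) rfl (by norm_num)]
  simp only [List.set, Nat.reduceAdd]
  rw [obs_add G port 1 (by norm_num) (by simp; omega) rfl (by norm_num)]
  simp only [List.set, List.getD_cons_succ, List.getD_cons_zero, Nat.reduceAdd, add_zero]
  obtain ⟨m, hm⟩ : ∃ m, n = m + 1 := Nat.exists_eq_succ_of_ne_zero s.pos.ne'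
  have hsq := walkObs_square G port (v := s) (t := t) (i := m) (a := 0)
    (16 * (24 * n ^ 2 * Nat.clog 2 n) + 7 + 4 * Nat.clog 2 n + 2 + 7) hn (hs.trans hn) (ht.trans hn) h1
    (by omega) (by rw [← hm]; nlinarith)
  rw [← hm, zero_add, ← pow_two] at hsq
  refine hsq.trans ?_
  rw [walkObs]
  have hA' : n ^ 2 + n ^ 2 + (n ^ 2 + n ^ 2) + (n ^ 2 + n ^ 2 + (n ^ 2 + n ^ 2)) +
      (n ^ 2 + n ^ 2 + (n ^ 2 + n ^ 2) + (n ^ 2 + n ^ 2 + (n ^ 2 + n ^ 2)) +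
        (n ^ 2 + n ^ 2 + (n ^ 2 + n ^ 2) + (n ^ 2 + n ^ 2 + (n ^ 2 + n ^ 2)))) = 24 * n ^ 2 := by ring
  rw [obs_add G port 1 (by norm_num) (by simp; omega) rfl (by norm_num)]
  simp only [List.set, List.getD_cons_succ, List.getD_cons_zero, Nat.reduceAdd]
  rw [obs_add G port 1 (by norm_num) (by simp; omega) rfl (by norm_num)]
  simp only [List.set, List.getD_cons_succ, List.getD_cons_zero, Nat.reduceAdd]
  rw [obs_add G port 1 (by norm_num) (by simp; omega) rfl (by norm_num)]
  simp only [List.set, List.getD_cons_succ, List.getD_cons_zero, Nat.reduceAdd]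
  rw [obs_add G port 1 (by norm_num) (by simp; omega) rfl (by norm_num)]
  simp only [List.set, List.getD_cons_succ, List.getD_cons_zero, Nat.reduceAdd]
  rw [obs_add G port 1 (by norm_num) (by simp; omega) rfl (by norm_num)]
  simp only [List.set, List.getD_cons_succ, List.getD_cons_zero, Nat.reduceAdd]
  rw [hA']
  rw [obs_const G port 1 (by norm_num) (by simp; omega) rfl (by norm_num)]
  simp only [List.set, Nat.reduceAdd]
  rw [obs_jumpPos G port 1 (by norm_num) (by simp; omega) rfl]
  simp only [List.getD_cons_succ, List.getD_cons_zero, one_pos, if_true]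
  have hcl := walkObs_clog G port (v := s) (t := t) (A := 24 * n ^ 2)
    (x6 := n ^ 2 + n ^ 2 + (n ^ 2 + n ^ 2) + (n ^ 2 + n ^ 2 + (n ^ 2 + n ^ 2)) +
        (n ^ 2 + n ^ 2 + (n ^ 2 + n ^ 2) + (n ^ 2 + n ^ 2 + (n ^ 2 + n ^ 2)))) rfl
    (16 * (24 * n ^ 2 * Nat.clog 2 n) + 7) hn (hs.trans hn) (ht.trans hn) h1 hA (by omega) hp (by omega)
    (Nat.clog 2 n) 0 (by simp)
  rw [pow_zero, mul_zero] at hcl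
  refine hcl.trans ?_
  rw [walkObs_walk G port t hn h1 hA hp _ s (by omega) (by omega) (by omega) (by omega)]
  simp

theorem walkTime_isBigO :
    (fun n => (walkTime n : ℝ)) =O[Filter.atTop] (fun n : ℕ => (n : ℝ) ^ 2 * Real.log n) := by
  refine Asymptotics.IsBigO.of_bound 800 ?_
  filter_upwards [Filter.eventually_ge_atTop 3] with n hn
  have hn' : (3 : ℝ) ≤ n := by exact_mod_cast hn
  have hlog : 1 ≤ Real.log n := by
    rw [Real.le_log_iff_exp_le (by linarith)]
    linarith [Real.exp_one_lt_d9]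
  have hc := clog_two_le_two_mul_log (n := n) (by omega)
  have hc0 : (0 : ℝ) ≤ Nat.clog 2 n := by positivity
  have h1 : (n : ℝ) ^ 2 * Nat.clog 2 n ≤ (n : ℝ) ^ 2 * (2 * Real.log n) :=
    mul_le_mul_of_nonneg_left hc (by positivity)
  have h2 : (n : ℝ) ^ 2 ≤ (n : ℝ) ^ 2 * Real.log n := le_mul_of_one_le_right (by positivity) hlog
  have h3 : (n : ℝ) ≤ (n : ℝ) ^ 2 := by nlinarith
  have h4 : Real.log n ≤ (n : ℝ) ^ 2 * Real.log n :=
    le_mul_of_one_le_left (by linarith) (by nlinarith)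
  rw [Real.norm_of_nonneg (by positivity), Real.norm_of_nonneg (by positivity), walkTime]
  push_cast
  nlinarith

/-- The bound on the space used by the program. -/
def walkSpace (n : ℕ) : ℕ := 12 * (4 + (7 + 4 * Nat.clog 2 n))

theorem walkSpace_isBigO :
    (fun n => (walkSpace n : ℝ)) =O[Filter.atTop] (fun n : ℕ => Real.log n) := by
  refine Asymptotics.IsBigO.of_bound 300 ?_
  filter_upwards [Filter.eventually_ge_atTop 3] with n hn
  have hn' : (3 : ℝ) ≤ n := by exact_mod_cast hn
  have hlog : 1 ≤ Real.log n := by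
    rw [Real.le_log_iff_exp_le (by linarith)]
    linarith [Real.exp_one_lt_d9]
  have hc := clog_two_le_two_mul_log (n := n) (by omega)
  rw [Real.norm_of_nonneg (by positivity), Real.norm_of_nonneg (by linarith), walkSpace]
  push_cast
  linarith

/-- With `x = 2 ^ Nat.clog 2 n` both `n` and the logarithm are at most `x`, so everything is at most
`24 x³ + 1 < 128 x⁴`. The exponent on the right is logarithmic in `n`, which yields logarithmic
space. -/
theorem card_steps_lt (n : ℕ) : 24 * n ^ 2 * Nat.clog 2 n + 1 < 2 ^ (7 + 4 * Nat.clog 2 n) ∧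
    24 * n ^ 2 < 2 ^ (7 + 4 * Nat.clog 2 n) ∧ n < 2 ^ (7 + 4 * Nat.clog 2 n) ∧
    2 ^ Nat.clog 2 n < 2 ^ (7 + 4 * Nat.clog 2 n) := by
  have h1 : n ≤ 2 ^ Nat.clog 2 n := Nat.le_pow_clog one_lt_two n
  have h2 : Nat.clog 2 n < 2 ^ Nat.clog 2 n := Nat.lt_two_pow_self
  have h3 : 2 ^ (7 + 4 * Nat.clog 2 n) = 128 * (2 ^ Nat.clog 2 n) ^ 4 := by
    rw [pow_add, mul_comm 4, pow_mul]
    norm_num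
  rw [h3]
  generalize 2 ^ Nat.clog 2 n = x at *
  generalize Nat.clog 2 n = c at *
  have hx : 1 ≤ x := by omega
  have hx3 : x ^ 3 ≤ x ^ 4 := Nat.pow_le_pow_right hx (by norm_num)
  have hx2 : x ^ 2 ≤ x ^ 4 := Nat.pow_le_pow_right hx (by norm_num)
  have hx1 : x ≤ x ^ 4 := Nat.le_self_pow (by norm_num) x
  have hn2 : n ^ 2 ≤ x ^ 2 := Nat.pow_le_pow_left h1 2
  have hN : n ^ 2 * c ≤ x ^ 2 * x := Nat.mul_le_mul hn2 h2.le
  have hx3' : x ^ 2 * x = x ^ 3 := by ring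
  have hx0 : 0 < x ^ 4 := by positivity
  have hx0 : 0 < x ^ 4 := by positivity
  rw [mul_assoc]
  omega

/-! ### One-sidedness of the error and conclusion -/

theorem reachable_of_mem_unitWalk_support {V : Type*} [Fintype V] [DecidableEq V] (G : SimpleGraph V)
    [DecidableRel G.Adj] (N : ℕ) (s : V) {p : List V} (hp : p ∈ (unitWalk G N s).support) {u : V}
    (hu : u ∈ p) : G.Reachable s u := by
  induction N generalizing s p with
  | zero =>
    simp only [unitWalk, trajectory, PMF.support_pure, Set.mem_singleton_iff] at hp
    subst hp
    rw [List.mem_singleton.1 hu]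
  | succ N ih =>
    rw [unitWalk_succ, PMF.mem_support_bind_iff] at hp
    obtain ⟨b, hb, hp⟩ := hp
    rw [PMF.mem_support_map_iff] at hp
    obtain ⟨q, hq, rfl⟩ := hp
    rcases List.mem_cons.1 hu with rfl | hu
    · exact SimpleGraph.Reachable.refl _
    · refine (reachable_of_mhWeight_ne_zero (f := fun _ => 1) G (u := b) fun h0 => ?_).trans (ih b hq hu)
      rw [PMF.mem_support_iff, mhStep_one_apply, h0] at hb
      simp at hb

theorem twelve_mul_le_floor {n : ℕ} (hn : 0 < n) :
    12 * n ^ 2 * Nat.clog 2 n ≤ ⌊24 * (n : ℝ) ^ 2 * Real.log n⌋₊ := by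
  refine Nat.le_floor ?_
  push_cast
  have := mul_le_mul_of_nonneg_left (clog_two_le_two_mul_log hn)
    (show (0 : ℝ) ≤ 12 * (n : ℝ) ^ 2 by positivity)
  linarith

end USTCON
end
theorem mainTheorem4 :
    -- the walk `RW(G_1)` from `s`, of `24 n² log n` steps
    (∀ (n : ℕ) (G : SimpleGraph (Fin n)) [DecidableRel G.Adj] (s t : Fin n), G.Reachable s t →
      1 - (n : ℝ≥0∞)⁻¹ ≤
        (USTCON.unitWalk G ⌊24 * (n : ℝ) ^ 2 * Real.log n⌋₊ s).toOuterMeasure {p | t ∈ p}) ∧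
    -- the algorithm: a single program `P`, time bound `T`, space bound `S`
    ∃ (P : USTCON.Program) (T S : ℕ → ℕ) (l r : ℕ),
      (fun n => (T n : ℝ)) =O[Filter.atTop] (fun n : ℕ => (n : ℝ) ^ 2 * Real.log n) ∧
      (fun n => (S n : ℝ)) =O[Filter.atTop] (fun n : ℕ => Real.log n) ∧
      ∀ (n : ℕ) (G : SimpleGraph (Fin n)) [DecidableRel G.Adj]
        (port : ∀ v : Fin n, G.neighborSet v ≃ Fin (G.degree v)) (s t : Fin n),
        -- every run halts within `T n` steps, in space `S n`
        (∀ τ ∈ (USTCON.execution G port P s t (T n)).support,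
          (∃ b, USTCON.answer P τ = some b) ∧ (∀ c ∈ τ, c.space ≤ S n)) ∧
        -- one-sided error at most `1 / n`
        (¬ G.Reachable s t →
          ((USTCON.execution G port P s t (T n)).map (USTCON.answer P)) (some true) = 0) ∧
        (G.Reachable s t →
          ((USTCON.execution G port P s t (T n)).map (USTCON.answer P)) (some false)
            ≤ (n : ℝ≥0∞)⁻¹) ∧
        -- the program runs the walk `RW(G_1)` from `s` and answers whether it has visited `t`
        (USTCON.execution G port P s t (T n)).map (USTCON.record l r) =
          (USTCON.unitWalk G (24 * n ^ 2 * Nat.clog 2 n) s).map (List.map fun v : Fin n => (v : ℕ)) ∧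
        (∀ τ ∈ (USTCON.execution G port P s t (T n)).support,
          (USTCON.answer P τ = some true ↔ (t : ℕ) ∈ USTCON.record l r τ)) := by
  refine ⟨fun n G _ s t hst => ?_, USTCON.walkProgram, USTCON.walkTime, USTCON.walkSpace, 16, 1,
    USTCON.walkTime_isBigO, USTCON.walkSpace_isBigO, fun n G _ port s t => ?_⟩
  · simpa using USTCON.unitWalk_mem_ge G hst (by simpa using USTCON.twelve_mul_le_floor s.pos)
  obtain ⟨hN, hA, hn, hp⟩ := USTCON.card_steps_lt n
  have hobs := USTCON.walkObs_init G port s t (Nat.one_lt_two_pow (by omega)) hn hA hp hN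
  rw [USTCON.obs] at hobs
  change PMF.map _ (USTCON.execution G port USTCON.walkProgram s t (USTCON.walkTime n)) = _ at hobs
  -- Equality of the laws of the views turns into a statement on each single run: its view lies in
  -- the support of the image of the walk, where the boundedness clause is `True`.
  have hsupp : ∀ τ ∈ (USTCON.execution G port USTCON.walkProgram s t (USTCON.walkTime n)).support,
      ∃ q : List (Fin n), USTCON.record 16 1 τ = q.map Fin.val ∧
        USTCON.answer USTCON.walkProgram τ = some (decide (t ∈ q)) ∧
        ∀ c ∈ τ, c.Bounded (2 ^ (7 + 4 * Nat.clog 2 n)) := by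
    intro τ hτ
    have h1 := (PMF.mem_support_map_iff (USTCON.view USTCON.walkProgram 16 1
      (2 ^ (7 + 4 * Nat.clog 2 n))) _ _).2 ⟨τ, hτ, rfl⟩
    rw [hobs, PMF.mem_support_map_iff] at h1
    obtain ⟨q, -, hq⟩ := h1
    simp only [USTCON.view, Prod.mk.injEq] at hq
    exact ⟨q, hq.1.symm, hq.2.1.symm, of_eq_true hq.2.2.symm⟩
  have hans : (USTCON.execution G port USTCON.walkProgram s t (USTCON.walkTime n)).map
      (USTCON.answer USTCON.walkProgram) =
      ((USTCON.unitWalk G (24 * n ^ 2 * Nat.clog 2 n) s).map fun q => decide (t ∈ q)).map some := by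
    have h := congrArg (PMF.map fun y : List ℕ × Option Bool × Prop => y.2.1) hobs
    rw [PMF.map_comp, PMF.map_comp] at h
    rw [PMF.map_comp]
    exact h
  have hrec := congrArg (PMF.map fun y : List ℕ × Option Bool × Prop => y.1) hobs
  rw [PMF.map_comp, PMF.map_comp] at hrec
  refine ⟨fun τ hτ => ?_, fun hst => ?_, fun hst => ?_, hrec, fun τ hτ => ?_⟩
  · obtain ⟨q, -, h2, h3⟩ := hsupp τ hτ
    exact ⟨⟨_, h2⟩, fun c hc => (h3 c hc).space_le⟩
  · rw [hans, PMF.apply_eq_zero_iff, PMF.map_comp, PMF.mem_support_map_iff]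
    rintro ⟨q, hq, h⟩
    have ht : t ∈ q := by simpa using h
    exact hst (USTCON.reachable_of_mem_unitWalk_support G _ s hq ht)
  · have hle := USTCON.map_mem_unitWalk_false_le G hst (N := 24 * n ^ 2 * Nat.clog 2 n) (by
      rw [Fintype.card_fin]
      gcongr
      norm_num)
    rw [Fintype.card_fin] at hle
    rw [hans]
    refine le_of_eq_of_le ?_ hle
    rw [PMF.map_apply, tsum_fintype, Fintype.sum_bool]
    simp
  · obtain ⟨q, h1, h2, -⟩ := hsupp τ hτ
    rw [h1, h2]
    simp [Fin.val_inj]
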